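/- For integers $n\ge k\ge 1$, an $(n,k)$-Sperner partition system is a set of partitions of some $n$-set such that each partition has exactly $k$ nonempty parts and no part of any partition in the set is a subset of a part of a different partition in the set. Let $\mathrm{SP}(n,k)$ be the maximum number of partitions in an $(n,k)$-Sperner partition system. Let $c$ and $r$ be the integers with $n=ck+r$ and $r\in\{0,\ldots,k-1\}$, and let $$\mathrm{MMS}(n,k)=\frac{\binom{n}{c}}{k-r+\frac{r(c+1)}{n-c}}.$$ Theorem. Let $n$ and $k$ be positive integers varying so that $n\to\infty$, $k\le \frac n2$ and $k-r=\Theta(n)$. Then $\mathrm{SP}(n,k)\sim\mathrm{MMS}(n,k)$, that is, $\mathrm{SP}(n,k)/\mathrm{MMS}(n,k)\to 1$. -/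

import Mathlib

open Filter Asymptotics

/-- A set `𝒮` of partitions of the finite ground set `α` is an `(n, k)`-Sperner partition system,
where `n` is the size of `α`: every partition in it has exactly `k` parts (the parts of a
`Finpartition` are nonempty), and no part of a partition in `𝒮` is a subset of a part of a
different partition in `𝒮`. -/
def IsSpernerPartitionSystem {α : Type*} [Fintype α] [DecidableEq α] (k : ℕ)
    (𝒮 : Finset (Finpartition (Finset.univ : Finset α))) : Prop :=
  (∀ P ∈ 𝒮, P.parts.card = k) ∧
    ∀ P ∈ 𝒮, ∀ Q ∈ 𝒮, P ≠ Q → ∀ A ∈ P.parts, ∀ B ∈ Q.parts, ¬ A ⊆ B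

/-- `SP n k` is the maximum number of partitions in an `(n, k)`-Sperner partition system. -/
noncomputable def SP (n k : ℕ) : ℕ :=
  sSup {N : ℕ | ∃ 𝒮 : Finset (Finpartition (Finset.univ : Finset (Fin n))),
    IsSpernerPartitionSystem k 𝒮 ∧ 𝒮.card = N}

/-- The supremum defining `SP n k` is a genuine maximum. -/
theorem SP_isGreatest (n k : ℕ) :
    IsGreatest {N : ℕ | ∃ 𝒮 : Finset (Finpartition (Finset.univ : Finset (Fin n))),
      IsSpernerPartitionSystem k 𝒮 ∧ 𝒮.card = N} (SP n k) := by
  have hb : BddAbove {N : ℕ | ∃ 𝒮 : Finset (Finpartition (Finset.univ : Finset (Fin n))),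
      IsSpernerPartitionSystem k 𝒮 ∧ 𝒮.card = N} := by
    refine ⟨Fintype.card (Finpartition (Finset.univ : Finset (Fin n))), ?_⟩
    rintro N ⟨𝒮, -, rfl⟩
    exact Finset.card_le_univ 𝒮
  refine ⟨Nat.sSup_mem ⟨0, ∅, ?_, rfl⟩ hb, fun N hN => le_csSup hb hN⟩
  simp [IsSpernerPartitionSystem]

/-- `quo n k` is the integer `c` in `n = c * k + r` with `0 ≤ r < k` (for `k ≥ 1`). -/
def quo (n k : ℕ) : ℕ := n / k

/-- `rem n k` is the integer `r` in `n = c * k + r` with `0 ≤ r < k` (for `k ≥ 1`). -/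
def rem (n k : ℕ) : ℕ := n % k

/-- `MMS(n, k) = C(n, c) / (k - r + r (c + 1) / (n - c))`, all operations being in `ℝ`. -/
noncomputable def MMS (n k : ℕ) : ℝ :=
  (n.choose (quo n k) : ℝ) /
    ((k : ℝ) - (rem n k : ℝ) +
      (rem n k : ℝ) * ((quo n k : ℝ) + 1) / ((n : ℝ) - (quo n k : ℝ)))

/-! Since k - r is of order n and k ≤ n/2, the quotient c lies between 2 and a constant, so it
suffices to treat each fixed c. Upper bound: the parts occurring in a Sperner system form an
antichain, and a ↦ 1/C(n, a) is convex. Among partitions into k parts, the LYM weight is therefore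
least for k - r parts of size c and r of size c + 1, and LYM gives exactly `MMS` (`SP_le_MMS`).
Lower bound: split the ground set into M = g(c + 1) cells, arranged in g groups of c + 1. The type
of a block is the set of cells it meets, each in one point. The allowed types are the groups and the
c-sets of cells contained in no group; these form an antichain, so only blocks of equal type could
be nested, and then they coincide. Each partition takes its a = k - r blocks of size c spread evenly
over the D scattered types, and its r blocks of size c + 1 spread evenly over the groups. A
Baranyai-type argument (`exists_block_labelling`) chooses points cell by cell by König edge
colouring, and yields N such partitions with all blocks distinct whenever every type has room for
its blocks (`le_SP_of_types`). Each cell has about n/M points, so scattered types allow N ≈ (n/M)^c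
D/a. For g large, D ≈ M^c/c!, so N ≈ C(n, c)/a ≥ `MMS`. The groups are no obstacle: they must hold
O(n^c) blocks and have room for order n^(c+1). -/

/-! ### Edge colouring of bipartite multigraphs. -/

theorem card_filter_mem_of_card_fiber {α V : Type*} [DecidableEq V] (f : α → V) (d : ℕ)
    (E : Finset α) (h : ∀ v, (E.filter (fun e => f e = v)).card = d) (S : Finset V) :
    (E.filter (fun e => f e ∈ S)).card = S.card * d := by
  have hmaps : Set.MapsTo f (E.filter (fun e => f e ∈ S) : Finset α) (S : Set V) :=
    fun e he => (Finset.mem_filter.1 (Finset.mem_coe.1 he)).2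
  rw [Finset.card_eq_sum_card_fiberwise hmaps, ← smul_eq_mul, ← Finset.sum_const]
  refine Finset.sum_congr rfl fun v hv => ?_
  rw [← h v, Finset.filter_filter]
  congr 1
  ext e
  simp only [Finset.mem_filter]
  constructor
  · rintro ⟨h, -, h'⟩; exact ⟨h, h'⟩
  · rintro ⟨h, rfl⟩; exact ⟨h, hv, rfl⟩

/-- A nonempty regular bipartite multigraph has a perfect matching. Edges are the elements of `E`,
with end-vertices given by `ℓ` and `ρ`. -/
theorem exists_perfect_matching_of_regular {α V W : Type*} [DecidableEq α] [Fintype V] [Fintype W]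
    [DecidableEq V] [DecidableEq W] (ℓ : α → V) (ρ : α → W) (d : ℕ) (E : Finset α)
    (hℓ : ∀ v, (E.filter (fun e => ℓ e = v)).card = d + 1)
    (hρ : ∀ w, (E.filter (fun e => ρ e = w)).card = d + 1) :
    ∃ F ⊆ E, (∀ v, (F.filter (fun e => ℓ e = v)).card = 1) ∧
      ∀ w, (F.filter (fun e => ρ e = w)).card = 1 := by
  have hcard : Fintype.card V = Fintype.card W := by
    have h1 : E.card = ∑ v : V, (E.filter (fun e => ℓ e = v)).card :=
      Finset.card_eq_sum_card_fiberwise (fun _ _ => Finset.mem_coe.2 (Finset.mem_univ _))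
    have h2 : E.card = ∑ w : W, (E.filter (fun e => ρ e = w)).card :=
      Finset.card_eq_sum_card_fiberwise (fun _ _ => Finset.mem_coe.2 (Finset.mem_univ _))
    simp only [hℓ, hρ, Finset.sum_const, Finset.card_univ, smul_eq_mul] at h1 h2
    exact Nat.eq_of_mul_eq_mul_right d.succ_pos (h1.symm.trans h2)
  -- Hall's condition by double counting: the (d + 1)|S| edges leaving S all end in its
  -- neighbourhood N, which receives only (d + 1)|N| edges.
  obtain ⟨φ, hφ, hφE⟩ := (Finset.all_card_le_biUnion_card_iff_exists_injective
    (fun v => (E.filter (fun e => ℓ e = v)).image ρ)).1 (by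
      intro S
      set N := S.biUnion (fun v => (E.filter (fun e => ℓ e = v)).image ρ)
      have h1 := card_filter_mem_of_card_fiber ℓ (d + 1) E hℓ S
      have h2 := card_filter_mem_of_card_fiber ρ (d + 1) E hρ N
      have h3 : (E.filter (fun e => ℓ e ∈ S)) ⊆ (E.filter (fun e => ρ e ∈ N)) := by
        intro e he
        rw [Finset.mem_filter] at he ⊢
        refine ⟨he.1, Finset.mem_biUnion.2 ⟨ℓ e, he.2, Finset.mem_image.2 ⟨e, ?_, rfl⟩⟩⟩
        exact Finset.mem_filter.2 ⟨he.1, rfl⟩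
      have h4 := Finset.card_le_card h3
      rw [h1, h2] at h4
      exact Nat.le_of_mul_le_mul_right h4 d.succ_pos)
  have hbij : Function.Bijective φ := (Fintype.bijective_iff_injective_and_card φ).2 ⟨hφ, hcard⟩
  have : ∀ v, ∃ e ∈ E, ℓ e = v ∧ ρ e = φ v := fun v => by
    obtain ⟨e, he, he'⟩ := Finset.mem_image.1 (hφE v)
    exact ⟨e, (Finset.mem_filter.1 he).1, (Finset.mem_filter.1 he).2, he'⟩
  choose m hmE hmℓ hmρ using this
  refine ⟨Finset.univ.image m, ?_, ?_, ?_⟩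
  · intro e he
    obtain ⟨v, -, rfl⟩ := Finset.mem_image.1 he
    exact hmE v
  · intro v
    rw [Finset.card_eq_one]
    refine ⟨m v, ?_⟩
    ext e
    simp only [Finset.mem_filter, Finset.mem_image, Finset.mem_univ, true_and,
      Finset.mem_singleton]
    constructor
    · rintro ⟨⟨v', rfl⟩, h⟩; rw [hmℓ] at h; rw [h]
    · rintro rfl; exact ⟨⟨v, rfl⟩, hmℓ v⟩
  · intro w
    obtain ⟨v, rfl⟩ := hbij.2 w
    rw [Finset.card_eq_one]
    refine ⟨m v, ?_⟩
    ext e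
    simp only [Finset.mem_filter, Finset.mem_image, Finset.mem_univ, true_and,
      Finset.mem_singleton]
    constructor
    · rintro ⟨⟨v', rfl⟩, h⟩; rw [hmρ] at h; rw [hφ h]
    · rintro rfl; exact ⟨⟨v, rfl⟩, hmρ v⟩

/-- A `d`-regular bipartite multigraph has a proper edge colouring with `d` colours. -/
theorem exists_edge_colouring_of_regular {α V W : Type*} [DecidableEq α] [Fintype V] [Fintype W]
    [DecidableEq V] [DecidableEq W] (ℓ : α → V) (ρ : α → W) (d : ℕ) (E : Finset α)
    (hℓ : ∀ v, (E.filter (fun e => ℓ e = v)).card = d)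
    (hρ : ∀ w, (E.filter (fun e => ρ e = w)).card = d) :
    ∃ h : α → ℕ, (∀ e ∈ E, h e < d) ∧ ∀ e ∈ E, ∀ e' ∈ E, h e = h e' →
      (ℓ e = ℓ e' ∨ ρ e = ρ e') → e = e' := by
  induction d generalizing E with
  | zero =>
    have hE : ∀ e, e ∉ E := fun e he => by
      have := Finset.card_eq_zero.1 (hℓ (ℓ e))
      exact Finset.notMem_empty e (this ▸ Finset.mem_filter.2 ⟨he, rfl⟩)
    exact ⟨fun _ => 0, fun e he => (hE e he).elim, fun e he => (hE e he).elim⟩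
  | succ d ih =>
    obtain ⟨F, hFE, hFℓ, hFρ⟩ := exists_perfect_matching_of_regular ℓ ρ d E hℓ hρ
    have hsub : ∀ (q : α → Prop) [DecidablePred q], (E.filter q).card = d + 1 →
        (F.filter q).card = 1 → ((E \ F).filter q).card = d := by
      intro q _ h1 h2
      have : (E \ F).filter q = E.filter q \ F.filter q := by
        ext e; simp only [Finset.mem_filter, Finset.mem_sdiff]; tauto
      rw [this, Finset.card_sdiff_of_subset (Finset.filter_subset_filter _ hFE), h1, h2]
      rfl
    obtain ⟨h, hlt, hinj⟩ := ih (E \ F) (fun v => hsub _ (hℓ v) (hFℓ v))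
      (fun w => hsub _ (hρ w) (hFρ w))
    have hFinj : ∀ e ∈ F, ∀ e' ∈ F, (ℓ e = ℓ e' ∨ ρ e = ρ e') → e = e' := by
      rintro e he e' he' (h | h)
      · exact Finset.card_le_one.1 (hFℓ (ℓ e')).le e (Finset.mem_filter.2 ⟨he, h⟩) e'
          (Finset.mem_filter.2 ⟨he', rfl⟩)
      · exact Finset.card_le_one.1 (hFρ (ρ e')).le e (Finset.mem_filter.2 ⟨he, h⟩) e'
          (Finset.mem_filter.2 ⟨he', rfl⟩)
    refine ⟨fun e => if e ∈ F then d else h e, ?_, ?_⟩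
    · intro e he
      by_cases heF : e ∈ F
      · simp [heF]
      · have := hlt e (Finset.mem_sdiff.2 ⟨he, heF⟩)
        simp only [heF, if_false]; omega
    · intro e he e' he' heq hor
      by_cases heF : e ∈ F <;> by_cases heF' : e' ∈ F
      · exact hFinj e heF e' heF' hor
      · have := hlt e' (Finset.mem_sdiff.2 ⟨he', heF'⟩)
        simp only [heF, heF', if_true, if_false] at heq; omega
      · have := hlt e (Finset.mem_sdiff.2 ⟨he, heF⟩)
        simp only [heF, heF', if_true, if_false] at heq; omega
      · simp only [heF, heF', if_false] at heq
        exact hinj e (Finset.mem_sdiff.2 ⟨he, heF⟩) e' (Finset.mem_sdiff.2 ⟨he', heF'⟩) heq hor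

/-- **König's edge colouring theorem**: a bipartite multigraph of maximum degree at most `d` has a
proper edge colouring with `d` colours. -/
theorem exists_edge_colouring {α V W : Type*} [Fintype α] [Fintype V] [Fintype W]
    [DecidableEq V] [DecidableEq W] (ℓ : α → V) (ρ : α → W) (d : ℕ)
    (hℓ : ∀ v, (Finset.univ.filter (fun e => ℓ e = v)).card ≤ d)
    (hρ : ∀ w, (Finset.univ.filter (fun e => ρ e = w)).card ≤ d) :
    ∃ h : α → ℕ, (∀ e, h e < d) ∧ ∀ e e', h e = h e' →
      (ℓ e = ℓ e' ∨ ρ e = ρ e') → e = e' := by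
  classical
  let dv : V → ℕ := fun v => d - (Finset.univ.filter (fun e => ℓ e = v)).card
  let dw : W → ℕ := fun w => d - (Finset.univ.filter (fun e => ρ e = w)).card
  -- Regularisation: a copy of the graph, a reversed copy, and at each vertex enough padding edges
  -- joining its two occurrences to raise the degree to d. The original edges are the `inl (inl e)`.
  let β := (α ⊕ α) ⊕ ((Σ v, Fin (dv v)) ⊕ (Σ w, Fin (dw w)))
  let L : β → V ⊕ W := Sum.elim (Sum.elim (fun e => .inl (ℓ e)) (fun e => .inr (ρ e)))
    (Sum.elim (fun x => .inl x.1) (fun x => .inr x.1))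
  let R : β → V ⊕ W := Sum.elim (Sum.elim (fun e => .inr (ρ e)) (fun e => .inl (ℓ e)))
    (Sum.elim (fun x => .inl x.1) (fun x => .inr x.1))
  have hv : ∀ v, Fintype.card {x : Σ v, Fin (dv v) // x.1 = v} = dv v := fun v => by
    rw [Fintype.card_congr (Equiv.sigmaSubtype v), Fintype.card_fin]
  have hw : ∀ w, Fintype.card {x : Σ w, Fin (dw w) // x.1 = w} = dw w := fun w => by
    rw [Fintype.card_congr (Equiv.sigmaSubtype w), Fintype.card_fin]
  have hreg : ∀ (G : β → V ⊕ W), (G = L ∨ G = R) → ∀ z,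
      ((Finset.univ : Finset β).filter (fun e => G e = z)).card = d := by
    intro G hG z
    rw [← Fintype.card_subtype]
    rw [Fintype.card_congr (Equiv.subtypeSum), Fintype.card_sum,
      Fintype.card_congr (Equiv.subtypeSum), Fintype.card_sum,
      Fintype.card_congr (Equiv.subtypeSum), Fintype.card_sum]
    have h1 := fun v => hℓ v
    have h2 := fun w => hρ w
    simp only [← Fintype.card_subtype] at h1 h2
    have h3 : ∀ v, dv v + Fintype.card {e // ℓ e = v} = d := fun v => by
      simp only [dv, ← Fintype.card_subtype]; have := h1 v; omega
    have h4 : ∀ w, dw w + Fintype.card {e // ρ e = w} = d := fun w => by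
      simp only [dw, ← Fintype.card_subtype]; have := h2 w; omega
    rcases hG with rfl | rfl <;> rcases z with v | w
    · simpa [L, hv, add_comm] using h3 v
    · simpa [L, hw, add_comm] using h4 w
    · simpa [R, hv, add_comm] using h3 v
    · simpa [R, hw, add_comm] using h4 w
  obtain ⟨h, hlt, hinj⟩ := exists_edge_colouring_of_regular L R d Finset.univ
    (hreg L (.inl rfl)) (hreg R (.inr rfl))
  refine ⟨fun e => h (.inl (.inl e)), fun e => hlt _ (Finset.mem_univ _), fun e e' heq hor => ?_⟩
  have := hinj (.inl (.inl e)) (Finset.mem_univ _) (.inl (.inl e')) (Finset.mem_univ _) heq (by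
    rcases hor with h | h
    · left; simp [L, h]
    · right; simp [R, h])
  exact Sum.inl.inj (Sum.inl.inj this)

/-- A bipartite multigraph with maximum degree at most `d` on the left and with degree at most
`d * R w` at each vertex `w` on the right has an edge colouring with `d` colours that is proper on
the left and uses each colour at most `R w` times at each `w` on the right. -/
theorem exists_equitable_edge_colouring {α V W : Type*} [Fintype α] [Fintype V] [Fintype W]
    [DecidableEq V] [DecidableEq W] (ℓ : α → V) (ρ : α → W) (d : ℕ) (R : W → ℕ)
    (hℓ : ∀ v, (Finset.univ.filter (fun e => ℓ e = v)).card ≤ d)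
    (hρ : ∀ w, (Finset.univ.filter (fun e => ρ e = w)).card ≤ d * R w) :
    ∃ h : α → ℕ, (∀ e, h e < d) ∧ (∀ e e', h e = h e' → ℓ e = ℓ e' → e = e') ∧
      ∀ w j, (Finset.univ.filter (fun e => ρ e = w ∧ h e = j)).card ≤ R w := by
  classical
  rcases Nat.eq_zero_or_pos d with rfl | hd
  · have : IsEmpty α := ⟨fun e => by
      have := Finset.card_eq_zero.1 (Nat.le_zero.1 (hℓ (ℓ e)))
      exact Finset.notMem_empty e (this ▸ Finset.mem_filter.2 ⟨Finset.mem_univ _, rfl⟩)⟩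
    exact ⟨fun _ => 0, fun e => this.elim e, fun e => this.elim e, fun w j => by simp⟩
  have hidx : ∀ w, ∃ ι : α → ℕ, (∀ e, ρ e = w → ι e < d * R w) ∧
      ∀ e e', ρ e = w → ρ e' = w → ι e = ι e' → e = e' := by
    intro w
    let F := Finset.univ.filter (fun e => ρ e = w)
    refine ⟨fun e => if he : e ∈ F then F.equivFin ⟨e, he⟩ else 0, ?_, ?_⟩
    · intro e he
      have heF : e ∈ F := Finset.mem_filter.2 ⟨Finset.mem_univ _, he⟩
      simp only [heF, dif_pos]
      exact (F.equivFin ⟨e, heF⟩).2.trans_le (hρ w)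
    · intro e e' he he' h
      have heF : e ∈ F := Finset.mem_filter.2 ⟨Finset.mem_univ _, he⟩
      have heF' : e' ∈ F := Finset.mem_filter.2 ⟨Finset.mem_univ _, he'⟩
      simp only [heF, heF', dif_pos] at h
      simpa using F.equivFin.injective (Fin.ext h)
  choose ι hιlt hιinj using hidx
  let K := ∑ w, R w
  have hKR : ∀ w, R w ≤ K := fun w =>
    Finset.single_le_sum (f := R) (fun _ _ => Nat.zero_le _) (Finset.mem_univ w)
  have hchunk : ∀ e, ι (ρ e) e / d < R (ρ e) := fun e =>
    Nat.div_lt_of_lt_mul (hιlt _ _ rfl)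
  -- Each right vertex w is split into `R w` vertices of degree at most d by cutting the numbered
  -- list of its edges into chunks of length d. A proper colouring then uses each colour at most
  -- once per chunk.
  let σ : α → W × Fin K := fun e => (ρ e, ⟨ι (ρ e) e / d, (hchunk e).trans_le (hKR _)⟩)
  obtain ⟨h, hlt, hinj⟩ := exists_edge_colouring ℓ σ d hℓ (by
    rintro ⟨w, q⟩
    calc _ ≤ (Finset.Ico (q.1 * d) (q.1 * d + d)).card := by
          refine Finset.card_le_card_of_injOn (ι w) ?_ ?_
          · intro e he
            obtain ⟨rfl, h2⟩ := Prod.mk.inj (Finset.mem_filter.1 he).2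
            have h3 : ι (ρ e) e / d = q.1 := congrArg Fin.val h2
            rw [Finset.mem_coe, Finset.mem_Ico, ← h3]
            have h4 := Nat.div_add_mod (ι (ρ e) e) d
            have h5 := Nat.mod_lt (ι (ρ e) e) hd
            rw [mul_comm] at h4
            constructor <;> omega
          · intro e he e' he' heq
            exact hιinj w e e' (Prod.mk.inj (Finset.mem_filter.1 he).2).1
              (Prod.mk.inj (Finset.mem_filter.1 he').2).1 heq
      _ = d := by simp)
  refine ⟨h, hlt, fun e e' h1 h2 => hinj e e' h1 (.inl h2), fun w j => ?_⟩
  calc _ ≤ (Finset.range (R w)).card := by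
        refine Finset.card_le_card_of_injOn (fun e => ι w e / d) ?_ ?_
        · intro e he
          obtain ⟨rfl, -⟩ := (Finset.mem_filter.1 he).2
          exact Finset.mem_coe.2 (Finset.mem_range.2 (hchunk e))
        · intro e he e' he' heq
          obtain ⟨h1, h2⟩ := (Finset.mem_filter.1 he).2
          obtain ⟨h1', h2'⟩ := (Finset.mem_filter.1 he').2
          refine hinj e e' (h2.trans h2'.symm) (.inr ?_)
          subst h1
          simp only [σ, Prod.mk.injEq, Fin.mk.injEq, h1', true_and]
          exact heq
    _ = R w := by simp

/-! ### Sperner systems from families of surjections. -/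

/-- The partition of the domain of a surjection into its fibres. -/
def fibrePartition {X B : Type*} [Fintype X] [DecidableEq X] [Fintype B] [DecidableEq B]
    (π : X → B) (hπ : Function.Surjective π) : Finpartition (Finset.univ : Finset X) :=
  Finpartition.ofExistsUnique
    (Finset.univ.image fun b => Finset.univ.filter fun x => π x = b)
    (fun _ _ => Finset.subset_univ _)
    (fun x _ => ⟨Finset.univ.filter fun y => π y = π x, by simp, by
      rintro _ ⟨h1, h2⟩
      obtain ⟨b, -, rfl⟩ := Finset.mem_image.1 h1
      rw [(Finset.mem_filter.1 h2).2]⟩)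
    (by
      intro h
      obtain ⟨b, -, hb⟩ := Finset.mem_image.1 h
      obtain ⟨x, rfl⟩ := hπ b
      exact Finset.notMem_empty x (hb ▸ Finset.mem_filter.2 ⟨Finset.mem_univ _, rfl⟩))

theorem mem_fibrePartition_parts {X B : Type*} [Fintype X] [DecidableEq X] [Fintype B]
    [DecidableEq B] (π : X → B) (hπ : Function.Surjective π) (A : Finset X) :
    A ∈ (fibrePartition π hπ).parts ↔ ∃ b, (Finset.univ.filter fun x => π x = b) = A := by
  simp [fibrePartition, Finpartition.ofExistsUnique]

theorem card_fibrePartition_parts {X B : Type*} [Fintype X] [DecidableEq X] [Fintype B]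
    [DecidableEq B] (π : X → B) (hπ : Function.Surjective π) :
    (fibrePartition π hπ).parts.card = Fintype.card B := by
  rw [← Finset.card_univ]
  refine Finset.card_image_of_injective _ fun b b' h => ?_
  obtain ⟨x, rfl⟩ := hπ b
  have : x ∈ Finset.univ.filter fun y => π y = b' := by
    rw [← show _ = Finset.univ.filter fun y => π y = b' from h]; simp
  exact (Finset.mem_filter.1 this).2

/-- A family of surjections such that no fibre of one is contained in a fibre of another gives a
Sperner partition system. -/
theorem le_SP_of_surjections {X B : Type*} [Fintype X] [Fintype B] [DecidableEq B] [Nonempty B]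
    (N : ℕ) (π : Fin N → X → B) (hπ : ∀ i, Function.Surjective (π i))
    (h : ∀ i i' b b', (∀ x, π i x = b → π i' x = b') → i = i') :
    N ≤ SP (Fintype.card X) (Fintype.card B) := by
  let e := (Fintype.equivFin X).symm
  let ϖ : Fin N → Fin (Fintype.card X) → B := fun i x => π i (e x)
  have hϖ : ∀ i, Function.Surjective (ϖ i) := fun i => (hπ i).comp e.surjective
  let F := fun i => fibrePartition (ϖ i) (hϖ i)
  have key : ∀ i i', ∀ A ∈ (F i).parts, ∀ A' ∈ (F i').parts, A ⊆ A' → i = i' := by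
    intro i i' A hA A' hA' hsub
    obtain ⟨b, rfl⟩ := (mem_fibrePartition_parts _ _ _).1 hA
    obtain ⟨b', rfl⟩ := (mem_fibrePartition_parts _ _ _).1 hA'
    refine h i i' b b' fun x hx => ?_
    have := hsub (Finset.mem_filter.2 ⟨Finset.mem_univ (e.symm x), by simpa [ϖ] using hx⟩)
    simpa [ϖ] using (Finset.mem_filter.1 this).2
  have hinj : Function.Injective F := by
    intro i i' hii
    obtain ⟨b⟩ := ‹Nonempty B›
    have hb := (mem_fibrePartition_parts (ϖ i) (hϖ i) _).2 ⟨b, rfl⟩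
    exact key i i' _ hb _ ((congrArg Finpartition.parts hii) ▸ hb) (Finset.Subset.refl _)
  refine (SP_isGreatest _ _).2 ⟨Finset.univ.image F, ⟨?_, ?_⟩, ?_⟩
  · intro Q hQ
    obtain ⟨i, -, rfl⟩ := Finset.mem_image.1 hQ
    exact card_fibrePartition_parts _ _
  · intro Q hQ Q' hQ' hne A hA A' hA' hsub
    obtain ⟨i, -, rfl⟩ := Finset.mem_image.1 hQ
    obtain ⟨i', -, rfl⟩ := Finset.mem_image.1 hQ'
    exact hne (congrArg F (key i i' A hA A' hA' hsub))
  · rw [Finset.card_image_of_injective _ hinj, Finset.card_univ, Fintype.card_fin]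

/-! ### Systems of transversal blocks with prescribed types. -/

theorem card_filter_sigma_fin {τ : Type*} [Fintype τ] (m : τ → ℕ) (q : τ → Prop)
    [DecidablePred q] :
    (Finset.univ.filter (fun b : Σ t, Fin (m t) => q b.1)).card =
      ∑ t ∈ Finset.univ.filter q, m t := by
  have : Finset.univ.filter (fun b : Σ t, Fin (m t) => q b.1) =
      (Finset.univ.filter q).sigma fun _ => Finset.univ := by
    ext b; simp
  rw [this, Finset.card_sigma]
  simp

/-- Labellings of the blocks of `N` partitions: the block `b` of type `t` of the `i`-th partition
uses the point `f p (i, b)` of the `p`-th cell for each `p ∈ T t`. In each partition the blocks using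
a given cell use different points of it, and no two blocks of the same type are equal. -/
theorem exists_block_labelling {P τ : Type*} [Fintype P] [DecidableEq P] [Fintype τ]
    [DecidableEq τ] (T : τ → Finset P) (m : τ → ℕ) (s : P → ℕ) (N : ℕ)
    (hs : ∀ p, s p = ∑ t ∈ Finset.univ.filter (fun t => p ∈ T t), m t)
    (hN : ∀ t, N * m t ≤ ∏ p ∈ T t, s p) :
    ∃ f : P → Fin N × (Σ t, Fin (m t)) → ℕ,
      (∀ p x, p ∈ T x.2.1 → f p x < s p) ∧
      (∀ p i b b', p ∈ T b.1 → p ∈ T b'.1 → f p (i, b) = f p (i, b') → b = b') ∧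
      ∀ x y, x.2.1 = y.2.1 → (∀ p ∈ T x.2.1, f p x = f p y) → x = y := by
  classical
  -- Induction on the set Q of cells already treated. The invariant is that blocks of one type that
  -- agree on Q number at most the product of `s p` over the type's remaining cells, the number of
  -- ways left to separate them.
  suffices H : ∀ Q : Finset P, ∃ f : P → Fin N × (Σ t, Fin (m t)) → ℕ,
      (∀ p ∈ Q, ∀ x, p ∈ T x.2.1 → f p x < s p) ∧
      (∀ p ∈ Q, ∀ i b b', p ∈ T b.1 → p ∈ T b'.1 → f p (i, b) = f p (i, b') → b = b') ∧
      ∀ x, (Finset.univ.filter (fun y : Fin N × (Σ t, Fin (m t)) => y.2.1 = x.2.1 ∧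
        ∀ p ∈ T x.2.1, p ∈ Q → f p y = f p x)).card ≤ ∏ p ∈ T x.2.1 \ Q, s p by
    obtain ⟨f, h1, h2, h3⟩ := H Finset.univ
    refine ⟨f, fun p => h1 p (Finset.mem_univ _), fun p => h2 p (Finset.mem_univ _),
      fun x y hxy hf => ?_⟩
    have := h3 y
    rw [Finset.sdiff_eq_empty_iff_subset.2 (Finset.subset_univ _), Finset.prod_empty] at this
    exact Finset.card_le_one.1 this x
      (Finset.mem_filter.2 ⟨Finset.mem_univ _, hxy, fun p hp _ => hf p (hxy ▸ hp)⟩) y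
      (Finset.mem_filter.2 ⟨Finset.mem_univ _, rfl, fun _ _ _ => rfl⟩)
  intro Q
  induction Q using Finset.induction_on with
  | empty =>
    refine ⟨fun _ _ => 0, by simp, by simp, fun x => ?_⟩
    have : Finset.univ.filter (fun y : Fin N × (Σ t, Fin (m t)) => y.2.1 = x.2.1 ∧
        ∀ p ∈ T x.2.1, p ∈ (∅ : Finset P) → 0 = 0) = Finset.univ ×ˢ
          Finset.univ.filter (fun b : Σ t, Fin (m t) => b.1 = x.2.1) := by
      ext y; simp
    rw [this, Finset.card_product, card_filter_sigma_fin m (fun t => t = x.2.1)]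
    simpa [Finset.filter_eq'] using hN x.2.1
  | insert p Q hpQ ih =>
    obtain ⟨f, h1, h2, h3⟩ := ih
    let E := {x : Fin N × (Σ t, Fin (m t)) // p ∈ T x.2.1}
    let C : Fin N × (Σ t, Fin (m t)) → Finset (Fin N × (Σ t, Fin (m t))) := fun x =>
      Finset.univ.filter (fun y => y.2.1 = x.2.1 ∧ ∀ p ∈ T x.2.1, p ∈ Q → f p y = f p x)
    have hself : ∀ x, x ∈ C x := fun x =>
      Finset.mem_filter.2 ⟨Finset.mem_univ _, rfl, fun _ _ _ => rfl⟩
    have hCeq : ∀ x y, y.2.1 = x.2.1 → (∀ p ∈ T x.2.1, p ∈ Q → f p y = f p x) → C y = C x := by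
      intro x y hxy hf
      ext z
      simp only [C, Finset.mem_filter, Finset.mem_univ, true_and, hxy]
      refine and_congr_right fun _ => forall_congr' fun p => forall_congr' fun hp =>
        forall_congr' fun hpQ => ?_
      rw [hf p hp hpQ]
    -- Edges are the blocks using cell p; each joins its partition to its class of so far
    -- indistinguishable blocks. Colours are the points of p: properness on the left keeps blocks of
    -- one partition apart, and the bound on the right divides the room of each class by `s p`.
    obtain ⟨h, hlt, hinj, hR⟩ := exists_equitable_edge_colouring
      (fun e : E => e.1.1) (fun e : E => (e.1.2.1, C e.1)) (s p)
      (fun w => ∏ q ∈ T w.1 \ insert p Q, s q)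
      (by
        intro i
        rw [hs p, ← card_filter_sigma_fin]
        refine Finset.card_le_card_of_injOn (fun e => e.1.2) ?_ ?_
        · intro e _
          simpa using e.2
        · intro e he e' he' hee
          have h1 : e.1.1 = i := (Finset.mem_filter.1 he).2
          have h2 : e'.1.1 = i := (Finset.mem_filter.1 he').2
          exact Subtype.ext (Prod.ext (h1.trans h2.symm) hee))
      (by
        rintro ⟨t, F⟩
        rcases Finset.eq_empty_or_nonempty
          (Finset.univ.filter (fun e : E => (e.1.2.1, C e.1) = (t, F))) with hempty | ⟨x, hx⟩
        · rw [hempty]; simp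
        obtain ⟨hxt, hxF⟩ := Prod.mk.inj (Finset.mem_filter.1 hx).2
        have hp : p ∈ T t := hxt ▸ x.2
        have hprod : s p * ∏ q ∈ T t \ insert p Q, s q = ∏ q ∈ T t \ Q, s q := by
          rw [Finset.sdiff_insert, Finset.mul_prod_erase _ s (Finset.mem_sdiff.2 ⟨hp, hpQ⟩)]
        rw [hprod, ← hxt]
        refine le_trans ?_ (h3 x.1)
        refine Finset.card_le_card_of_injOn Subtype.val ?_ (fun _ _ _ _ h => Subtype.ext h)
        intro y hy
        have hyF := (Prod.mk.inj (Finset.mem_filter.1 hy).2).2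
        have := hself y.1
        rw [hyF, ← hxF] at this
        exact this)
    refine ⟨fun q x => if q = p then (if hp : p ∈ T x.2.1 then h ⟨x, hp⟩ else 0) else f q x,
      ?_, ?_, ?_⟩
    · intro q hq x hx
      by_cases hqp : q = p
      · subst hqp
        simp only [if_true, hx, dif_pos]
        exact hlt _
      · simp only [hqp, if_false]
        exact h1 q ((Finset.mem_insert.1 hq).resolve_left hqp) x hx
    · intro q hq i b b' hb hb' heq
      by_cases hqp : q = p
      · subst hqp
        simp only [if_true, hb, hb', dif_pos] at heq
        have := hinj _ _ heq rfl
        exact (Prod.mk.inj (congrArg Subtype.val this)).2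
      · simp only [hqp, if_false] at heq
        exact h2 q ((Finset.mem_insert.1 hq).resolve_left hqp) i b b' hb hb' heq
    · intro x
      have hfQ : ∀ y : Fin N × (Σ t, Fin (m t)), (∀ q ∈ T x.2.1, q ∈ insert p Q →
          (if q = p then (if hp : p ∈ T y.2.1 then h ⟨y, hp⟩ else 0) else f q y) =
          (if q = p then (if hp : p ∈ T x.2.1 then h ⟨x, hp⟩ else 0) else f q x)) →
          ∀ q ∈ T x.2.1, q ∈ Q → f q y = f q x := by
        intro y hy q hq hqQ
        have hqp : q ≠ p := fun h => hpQ (h ▸ hqQ)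
        simpa [hqp] using hy q hq (Finset.mem_insert_of_mem hqQ)
      by_cases hp : p ∈ T x.2.1
      · refine le_trans ?_ (hR (x.2.1, C x) (h ⟨x, hp⟩))
        refine le_trans (Finset.card_le_card ?_) (Finset.card_image_le (f := Subtype.val))
        intro y hy
        obtain ⟨-, hyt, hyf⟩ := Finset.mem_filter.1 hy
        have hpy : p ∈ T y.2.1 := hyt ▸ hp
        refine Finset.mem_image.2 ⟨⟨y, hpy⟩, Finset.mem_filter.2 ⟨Finset.mem_univ _, ?_, ?_⟩, rfl⟩
        · exact Prod.ext hyt (hCeq x y hyt (hfQ y hyf))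
        · simpa [hp, hpy] using hyf p hp (Finset.mem_insert_self _ _)
      · have : T x.2.1 \ insert p Q = T x.2.1 \ Q := by
          rw [Finset.sdiff_insert, Finset.erase_eq_of_notMem]
          simp [hp]
        rw [this]
        refine le_trans (Finset.card_le_card ?_) (h3 x)
        intro y hy
        obtain ⟨-, hyt, hyf⟩ := Finset.mem_filter.1 hy
        exact Finset.mem_filter.2 ⟨Finset.mem_univ _, hyt, hfQ y hyf⟩

/-- Divide the ground set into cells indexed by `P`, and let `T` be an antichain of sets of cells.
If each type `T t` has room for `N * m t` different transversal blocks, then there are `N` partitions,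
each with `m t` blocks of type `T t` for each `t`, which form a Sperner partition system. -/
theorem le_SP_of_types {P τ : Type*} [Fintype P] [DecidableEq P] [Fintype τ]
    [DecidableEq τ] (T : τ → Finset P) (m : τ → ℕ) (s : P → ℕ) (N : ℕ)
    (hs : ∀ p, s p = ∑ t ∈ Finset.univ.filter (fun t => p ∈ T t), m t)
    (hN : ∀ t, N * m t ≤ ∏ p ∈ T t, s p) (hne : ∀ t, (T t).Nonempty)
    (hT : ∀ t t', T t ⊆ T t' → t = t') (hpos : 0 < ∑ t, m t) :
    N ≤ SP (∑ t, m t * (T t).card) (∑ t, m t) := by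
  classical
  obtain ⟨f, hlt, hinj, hdist⟩ := exists_block_labelling T m s N hs hN
  have hcB : Fintype.card (Σ t, Fin (m t)) = ∑ t, m t := by simp
  have hcX : Fintype.card (Σ p, Fin (s p)) = ∑ t, m t * (T t).card := by
    simp only [Fintype.card_sigma, Fintype.card_fin, hs, Finset.sum_filter]
    rw [Finset.sum_comm]
    refine Finset.sum_congr rfl fun t _ => ?_
    rw [← Finset.sum_filter, Finset.sum_const, smul_eq_mul, mul_comm]
    congr 2
    ext p; simp
  -- In each partition exactly `s p` blocks use cell p, at distinct points, so they exhaust the cell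
  -- and every point lies in exactly one block.
  have hbij : ∀ i (p : P), Function.Bijective
      (fun b : {b : Σ t, Fin (m t) // p ∈ T b.1} =>
        (⟨f p (i, b.1), hlt p (i, b.1) b.2⟩ : Fin (s p))) := by
    intro i p
    rw [Fintype.bijective_iff_injective_and_card]
    constructor
    · intro b b' h
      exact Subtype.ext (hinj p i b.1 b'.1 b.2 b'.2 (congrArg Fin.val h))
    · rw [Fintype.card_subtype, card_filter_sigma_fin m (fun t => p ∈ T t), ← hs,
        Fintype.card_fin]
  have hex : ∀ i (x : Σ p, Fin (s p)), ∃ b : Σ t, Fin (m t),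
      x.1 ∈ T b.1 ∧ f x.1 (i, b) = x.2 := by
    rintro i ⟨p, x⟩
    obtain ⟨b, hb⟩ := (hbij i p).2 x
    exact ⟨b.1, b.2, congrArg Fin.val hb⟩
  choose π hπT hπf using hex
  have hπ : ∀ i b p (hp : p ∈ T b.1), π i ⟨p, ⟨f p (i, b), hlt p (i, b) hp⟩⟩ = b :=
    fun i b p hp =>
      hinj p i _ _ (hπT i ⟨p, ⟨f p (i, b), hlt p (i, b) hp⟩⟩) hp
        (hπf i ⟨p, ⟨f p (i, b), hlt p (i, b) hp⟩⟩)
  have : Nonempty (Σ t, Fin (m t)) := Fintype.card_pos_iff.1 (hcB ▸ hpos)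
  rw [← hcX, ← hcB]
  refine le_SP_of_surjections N π (fun i b => ?_) fun i i' b b' h => ?_
  · obtain ⟨p, hp⟩ := hne b.1
    exact ⟨_, hπ i b p hp⟩
  -- Containment of blocks forces containment of types, hence equal types, and then equal labels on
  -- every cell.
  · have key : ∀ p, p ∈ T b.1 → p ∈ T b'.1 ∧ f p (i', b') = f p (i, b) := by
      intro p hp
      have h1 := h _ (hπ i b p hp)
      constructor
      · have := hπT i' ⟨p, ⟨f p (i, b), hlt p (i, b) hp⟩⟩
        rwa [h1] at this
      · have := hπf i' ⟨p, ⟨f p (i, b), hlt p (i, b) hp⟩⟩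
        rwa [h1] at this
    have htt : b.1 = b'.1 := hT _ _ fun p hp => (key p hp).1
    exact (Prod.mk.inj (hdist (i, b) (i', b') htt fun p hp => (key p hp).2.symm)).1

/-! ### The upper bound: convexity and the LYM inequality. -/

/-- Convexity of a ↦ 1/C(n, a). With n = a + 2 + b, the second difference is a positive multiple of
(a - b)² + a + b + 2. -/
theorem two_mul_inv_choose_le (n a : ℕ) (ha : a + 2 ≤ n) :
    2 * ((n.choose (a + 1) : ℝ))⁻¹ ≤ ((n.choose a : ℝ))⁻¹ + ((n.choose (a + 2) : ℝ))⁻¹ := by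
  obtain ⟨b, rfl⟩ := Nat.exists_eq_add_of_le ha
  have h0 : (0 : ℝ) < (a + 2 + b).choose (a + 1) := by
    exact_mod_cast Nat.choose_pos (by omega)
  have hA : ((a + 2 + b).choose a : ℝ)  =
      (a + 2 + b).choose (a + 1) * (a + 1) / (b + 2) := by
    have := Nat.choose_succ_right_eq (a + 2 + b) a
    rw [show a + 2 + b - a = b + 2 by omega] at this
    rw [eq_div_iff (by positivity)]
    exact_mod_cast this.symm
  have hB : ((a + 2 + b).choose (a + 2) : ℝ)  =
      (a + 2 + b).choose (a + 1) * (b + 1) / (a + 2) := by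
    have := Nat.choose_succ_right_eq (a + 2 + b) (a + 1)
    rw [show a + 2 + b - (a + 1) = b + 1 by omega] at this
    rw [eq_div_iff (by positivity)]
    exact_mod_cast this
  rw [hA, hB, inv_div, inv_div]
  set x : ℝ := ((a + 2 + b).choose (a + 1) : ℝ)
  have : ((b : ℝ) + 2) / (x * (a + 1)) + (a + 2) / (x * (b + 1)) - 2 * x⁻¹ =
      x⁻¹ * ((((a : ℝ) - b) ^ 2 + a + b + 2) / ((a + 1) * (b + 1))) := by
    field_simp
    ring
  have h2 : 0 ≤ x⁻¹ * ((((a : ℝ) - b) ^ 2 + a + b + 2) / ((a + 1) * (b + 1))) := by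
    positivity
  linarith

/-- A convex sequence lies above its tangent lines. -/
theorem tangent_le_of_convex_seq (f : ℕ → ℝ) (n c : ℕ) (hc : c < n)
    (hf : ∀ a, a + 2 ≤ n → 2 * f (a + 1) ≤ f a + f (a + 2)) (a : ℕ) (ha : a ≤ n) :
    f c + ((a : ℝ) - c) * (f (c + 1) - f c) ≤ f a := by
  have hmono : ∀ i j, i ≤ j → j < n → f (i + 1) - f i ≤ f (j + 1) - f j := by
    intro i j hij
    induction j, hij using Nat.le_induction with
    | base => intro _; exact le_rfl
    | succ j _ ih =>
      intro hj
      have h1 := ih (by omega)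
      have h2 := hf j (by omega)
      rw [show j + 1 + 1 = j + 2 by omega]
      linarith
  rcases le_total c a with hca | hca
  · obtain ⟨j, rfl⟩ := Nat.exists_eq_add_of_le hca
    clear hca
    induction j with
    | zero => simp
    | succ j ih =>
      have h1 := ih (by omega)
      have h2 := hmono c (c + j) (by omega) (by omega)
      rw [show c + j + 1 = c + (j + 1) by omega] at h2
      push_cast at h1 ⊢
      linarith
  · obtain ⟨j, rfl⟩ := Nat.exists_eq_add_of_le hca
    -- Here the tangent point is c = a + j, and the induction walks i steps to its left.
    have h3 : ∀ i, i ≤ j → f (a + j) + ((a + j - i : ℝ) - (a + j)) *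
        (f (a + j + 1) - f (a + j)) ≤ f (a + (j - i)) := by
      intro i
      induction i with
      | zero => intro _; simp
      | succ i ih =>
        intro hi
        have h1 := ih (by omega)
        have h2 := hmono (a + (j - (i + 1))) (a + j) (by omega) (by omega)
        rw [show a + (j - (i + 1)) + 1 = a + (j - i) by omega] at h2
        push_cast
        linarith
    have := h3 j le_rfl
    simp only [Nat.sub_self, add_zero] at this
    push_cast
    linarith

/-- The sets in the partitions of a Sperner partition system form an antichain, so that the
LYM inequality applies to them. -/
theorem IsSpernerPartitionSystem.sum_inv_choose_le_one {n k : ℕ}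
    {𝒮 : Finset (Finpartition (Finset.univ : Finset (Fin n)))}
    (h : IsSpernerPartitionSystem k 𝒮) :
    ∑ P ∈ 𝒮, ∑ A ∈ P.parts, ((n.choose A.card : ℝ))⁻¹ ≤ 1 := by
  classical
  have hanti : IsAntichain (· ⊆ ·) ((𝒮.biUnion fun P => P.parts : Finset (Finset (Fin n))) :
      Set (Finset (Fin n))) := by
    intro A hA B hB hne hsub
    obtain ⟨P, hP, hAP⟩ := Finset.mem_biUnion.1 (Finset.mem_coe.1 hA)
    obtain ⟨Q, hQ, hBQ⟩ := Finset.mem_biUnion.1 (Finset.mem_coe.1 hB)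
    by_cases hPQ : P = Q
    · subst hPQ
      obtain ⟨x, hx⟩ := P.nonempty_of_mem_parts hAP
      exact hne (P.eq_of_mem_parts hAP hBQ hx (hsub hx))
    · exact h.2 P hP Q hQ hPQ A hAP B hBQ hsub
  have := Finset.lubell_yamamoto_meshalkin_inequality_sum_inv_choose (𝕜 := ℝ) hanti
  rw [Finset.sum_biUnion] at this
  · simpa using this
  · intro P hP Q hQ hPQ
    rw [Function.onFun, Finset.disjoint_left]
    intro A hAP hAQ
    exact h.2 P hP Q hQ hPQ A hAP A hAQ (Finset.Subset.refl _)

/-- Replace 1/C(n, ·) by the line through its values at c and c + 1, which lies below it. The sum of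
a linear function over the parts depends only on their number k and total size n = ck + r. -/
theorem sum_inv_choose_parts_ge {n k : ℕ} (hc : quo n k < n)
    (P : Finpartition (Finset.univ : Finset (Fin n))) (hP : P.parts.card = k) :
    ((k : ℝ) - rem n k) * ((n.choose (quo n k) : ℝ))⁻¹ +
      rem n k * ((n.choose (quo n k + 1) : ℝ))⁻¹ ≤
        ∑ A ∈ P.parts, ((n.choose A.card : ℝ))⁻¹ := by
  set c := quo n k
  set f : ℕ → ℝ := fun a => ((n.choose a : ℝ))⁻¹
  have hn : (n : ℝ) = k * c + rem n k := by
    exact_mod_cast (Nat.div_add_mod n k).symm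
  have hsum : ∑ A ∈ P.parts, (A.card : ℝ) = n := by
    have := P.sum_card_parts
    simp only [Finset.card_univ, Fintype.card_fin] at this
    exact_mod_cast this
  calc _ = ∑ A ∈ P.parts, (f c + ((A.card : ℝ) - c) * (f (c + 1) - f c)) := by
        rw [Finset.sum_add_distrib, ← Finset.sum_mul, Finset.sum_sub_distrib, hsum,
          Finset.sum_const, Finset.sum_const, hP, hn]
        simp only [nsmul_eq_mul, f]
        ring
    _ ≤ _ := by
        refine Finset.sum_le_sum fun A _ => ?_
        refine tangent_le_of_convex_seq f n c hc (fun a ha => two_mul_inv_choose_le n a ha) _ ?_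
        simpa using Finset.card_le_univ A

theorem MMS_denom_pos {n k : ℕ} (hk : 0 < k) (hc : quo n k < n) :
    (0 : ℝ) < (k : ℝ) - rem n k + rem n k * ((quo n k : ℝ) + 1) / ((n : ℝ) - quo n k) := by
  have h1 : (rem n k : ℝ) < k := by exact_mod_cast Nat.mod_lt n hk
  have h2 : (quo n k : ℝ) < n := by exact_mod_cast hc
  have h3 : 0 ≤ (rem n k : ℝ) * ((quo n k : ℝ) + 1) / ((n : ℝ) - quo n k) :=
    div_nonneg (by positivity) (by linarith)
  linarith

/-- The Meagher–Moura–Stevens upper bound. -/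
theorem SP_le_MMS {n k : ℕ} (hk : 0 < k) (hc : quo n k < n) : (SP n k : ℝ) ≤ MMS n k := by
  obtain ⟨𝒮, h𝒮, hcard⟩ := (SP_isGreatest n k).1
  have h1 := h𝒮.sum_inv_choose_le_one
  have h2 : (SP n k : ℝ) * (((k : ℝ) - rem n k) * ((n.choose (quo n k) : ℝ))⁻¹ +
      rem n k * ((n.choose (quo n k + 1) : ℝ))⁻¹) ≤ 1 := by
    refine le_trans ?_ h1
    rw [← hcard, ← nsmul_eq_mul, ← Finset.sum_const]
    exact Finset.sum_le_sum fun P hP => sum_inv_choose_parts_ge hc P (h𝒮.1 P hP)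
  have hC : (0 : ℝ) < n.choose (quo n k) := by exact_mod_cast Nat.choose_pos hc.le
  have hnc : (0 : ℝ) < (n : ℝ) - quo n k := by
    have : (quo n k : ℝ) < n := by exact_mod_cast hc
    linarith
  have hC' : (n.choose (quo n k + 1) : ℝ) =
      n.choose (quo n k) * ((n : ℝ) - quo n k) / (quo n k + 1) := by
    rw [eq_div_iff (by positivity), ← Nat.cast_sub hc.le]
    exact_mod_cast Nat.choose_succ_right_eq n (quo n k)
  rw [MMS, le_div_iff₀ (MMS_denom_pos hk hc)]
  rw [hC', inv_div] at h2
  have h3 : ((k : ℝ) - rem n k) * ((n.choose (quo n k) : ℝ))⁻¹ +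
      rem n k * (((quo n k : ℝ) + 1) / (n.choose (quo n k) * ((n : ℝ) - quo n k))) =
      ((k : ℝ) - rem n k + rem n k * ((quo n k : ℝ) + 1) / ((n : ℝ) - quo n k)) /
        n.choose (quo n k) := by
    field_simp
  rw [h3, ← mul_div_assoc, div_le_one hC] at h2
  exact h2

/-! ### The construction from scattered sets and groups of cells. -/

/-- An integer can be divided into almost equal parts. -/
theorem exists_balanced_distribution {τ : Type*} [Fintype τ] [DecidableEq τ] [Nonempty τ] (a : ℕ) :
    ∃ m : τ → ℕ, ∑ t, m t = a ∧ ∀ t, a / Fintype.card τ ≤ m t ∧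
      m t ≤ a / Fintype.card τ + 1 := by
  obtain ⟨S, -, hS⟩ := Finset.exists_subset_card_eq (s := (Finset.univ : Finset τ))
    (n := a % Fintype.card τ) (by
      rw [Finset.card_univ]; exact (Nat.mod_lt _ Fintype.card_pos).le)
  refine ⟨fun t => a / Fintype.card τ + if t ∈ S then 1 else 0, ?_, fun t => ?_⟩
  · rw [Finset.sum_add_distrib, Finset.sum_const, Finset.card_univ, smul_eq_mul,
      Finset.sum_boole]
    simp only [Finset.filter_univ_mem, hS, Nat.cast_id]
    exact Nat.div_add_mod _ _
  · dsimp only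
    split_ifs <;> omega

section cells

/-- The `j`-th group of cells. -/
def cellGroup (g c : ℕ) (j : Fin g) : Finset (Fin g × Fin (c + 1)) :=
  Finset.univ.filter fun p => p.1 = j

theorem mem_cellGroup {g c : ℕ} {j : Fin g} {p : Fin g × Fin (c + 1)} :
    p ∈ cellGroup g c j ↔ p.1 = j := by
  simp [cellGroup]

theorem card_cellGroup (g c : ℕ) (j : Fin g) : (cellGroup g c j).card = c + 1 := by
  have : cellGroup g c j = {j} ×ˢ Finset.univ := by
    ext ⟨i, x⟩; simp [cellGroup, eq_comm]
  rw [this, Finset.card_product]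
  simp

/-- The `c`-sets of cells that lie within a group. -/
def groupedSets (g c : ℕ) : Finset (Finset (Fin g × Fin (c + 1))) :=
  Finset.univ.image fun p => (cellGroup g c p.1).erase p

theorem mem_groupedSets {g c : ℕ} {S : Finset (Fin g × Fin (c + 1))} (hS : S.card = c) (j : Fin g)
    (h : S ⊆ cellGroup g c j) : S ∈ groupedSets g c := by
  have h1 : (cellGroup g c j \ S).card = 1 := by
    rw [Finset.card_sdiff_of_subset h, card_cellGroup, hS]; omega
  obtain ⟨p, hp⟩ := Finset.card_eq_one.1 h1
  have hpj : p ∈ cellGroup g c j \ S := hp ▸ Finset.mem_singleton_self p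
  have hpj' : p.1 = j := mem_cellGroup.1 (Finset.mem_sdiff.1 hpj).1
  refine Finset.mem_image.2 ⟨p, Finset.mem_univ _, ?_⟩
  rw [hpj', Finset.erase_eq, ← hp, Finset.sdiff_sdiff_eq_self h]

theorem groupedSets_subset (g c : ℕ) :
    groupedSets g c ⊆ Finset.univ.powersetCard c := by
  intro S hS
  obtain ⟨p, -, rfl⟩ := Finset.mem_image.1 hS
  rw [Finset.mem_powersetCard]
  refine ⟨Finset.subset_univ _, ?_⟩
  rw [Finset.card_erase_of_mem (mem_cellGroup.2 rfl), card_cellGroup]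
  rfl

/-- A nonempty grouped set determines its group and the omitted cell; for c = 0 all of them would be
empty. -/
theorem card_groupedSets (g c : ℕ) (hc : 0 < c) : (groupedSets g c).card = g * (c + 1) := by
  rw [groupedSets, Finset.card_image_of_injective]
  · simp
  · intro p q h
    dsimp only at h
    have hcard : 0 < ((cellGroup g c p.1).erase p).card := by
      rw [Finset.card_erase_of_mem (mem_cellGroup.2 rfl), card_cellGroup]; exact hc
    obtain ⟨x, hx⟩ := Finset.card_pos.1 hcard
    have h1 : x.1 = p.1 := mem_cellGroup.1 (Finset.mem_of_mem_erase hx)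
    rw [h] at hx
    have h2 : x.1 = q.1 := mem_cellGroup.1 (Finset.mem_of_mem_erase hx)
    rw [← h1.symm.trans h2] at h
    exact (Finset.erase_inj _ (mem_cellGroup.2 rfl)).1 h

theorem card_filter_groupedSets_le (g c : ℕ) (p : Fin g × Fin (c + 1)) :
    ((groupedSets g c).filter (fun S => p ∈ S)).card ≤ c := by
  have : (groupedSets g c).filter (fun S => p ∈ S) ⊆
      ((cellGroup g c p.1).erase p).image fun q => (cellGroup g c p.1).erase q := by
    intro S hS
    obtain ⟨hS, hp⟩ := Finset.mem_filter.1 hS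
    obtain ⟨q, -, rfl⟩ := Finset.mem_image.1 hS
    have h1 := mem_cellGroup.1 (Finset.mem_of_mem_erase hp)
    refine Finset.mem_image.2 ⟨q, Finset.mem_erase.2 ⟨(Finset.ne_of_mem_erase hp).symm,
      mem_cellGroup.2 h1.symm⟩, ?_⟩
    rw [h1]
  refine (Finset.card_le_card this).trans (Finset.card_image_le.trans ?_)
  rw [Finset.card_erase_of_mem (mem_cellGroup.2 rfl), card_cellGroup]
  exact le_rfl

/-- The `c`-sets of cells that do not lie within a group. -/
def scatteredSets (g c : ℕ) : Finset (Finset (Fin g × Fin (c + 1))) :=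
  Finset.univ.powersetCard c \ groupedSets g c

theorem card_scatteredSets (g c : ℕ) (hc : 0 < c) :
    (scatteredSets g c).card + g * (c + 1) = (g * (c + 1)).choose c := by
  rw [scatteredSets, ← card_groupedSets g c hc,
    Finset.card_sdiff_add_card_eq_card (groupedSets_subset g c), Finset.card_powersetCard,
    card_groupedSets g c hc]
  simp

/-- Every cell lies in at least the average number of scattered sets, so no cell receives too few
points. All c-sets give degree C(M - 1, c - 1), grouped sets take away at most c, and M C(M - 1, c -
1) = c C(M, c) = c(D + M) for M = g(c + 1). -/
theorem mul_card_scatteredSets_le (g c : ℕ) (hc : 0 < c) (p : Fin g × Fin (c + 1)) :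
    c * (scatteredSets g c).card ≤
      g * (c + 1) * ((scatteredSets g c).filter (fun S => p ∈ S)).card := by
  have h1 : (g * (c + 1) - 1).choose (c - 1) ≤
      ((scatteredSets g c).filter (fun S => p ∈ S)).card + c := by
    have h2 := Finset.card_filter_powersetCard_subset {p} Finset.univ c
      (Finset.subset_univ _) (by rw [Finset.card_singleton]; exact hc)
    simp only [Finset.singleton_subset_iff, Finset.card_univ, Fintype.card_prod, Fintype.card_fin,
      Finset.card_singleton] at h2
    rw [← h2]
    refine le_trans ?_ (Nat.add_le_add_left (card_filter_groupedSets_le g c p) _)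
    refine le_trans (Finset.card_le_card ?_) (Finset.card_union_le _ _)
    intro S hS
    obtain ⟨hS, hp⟩ := Finset.mem_filter.1 hS
    by_cases h : S ∈ groupedSets g c
    · exact Finset.mem_union_right _ (Finset.mem_filter.2 ⟨h, hp⟩)
    · exact Finset.mem_union_left _ (Finset.mem_filter.2 ⟨Finset.mem_sdiff.2 ⟨hS, h⟩, hp⟩)
  have h3 := card_scatteredSets g c hc
  have hM : 0 < g * (c + 1) := Nat.mul_pos p.1.pos c.succ_pos
  set M := g * (c + 1)
  have h4 := Nat.add_one_mul_choose_eq (M - 1) (c - 1)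
  rw [Nat.sub_add_cancel hM, Nat.sub_add_cancel hc] at h4
  have h5 := Nat.mul_le_mul_left M h1
  rw [h4, ← h3] at h5
  nlinarith

end cells

/-- A lower bound on `SP` with explicit parameters. -/
theorem le_SP_of_scatteredSets (g c a r N L : ℕ) (hg : 0 < g) (hc : 0 < c) (ha : 0 < a)
    (hD : 0 < (scatteredSets g c).card)
    (hL : g * (c + 1) * L + (c * (scatteredSets g c).card + g * (c + 1)) ≤ c * a + (c + 1) * r)
    (h1 : N * (a / (scatteredSets g c).card + 1) ≤ L ^ c)
    (h2 : N * (r / g + 1) ≤ L ^ (c + 1)) :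
    N ≤ SP (c * a + (c + 1) * r) (a + r) := by
  classical
  have : Nonempty (Fin g) := ⟨⟨0, hg⟩⟩
  have : Nonempty (scatteredSets g c) := by
    obtain ⟨S, hS⟩ := Finset.card_pos.1 hD
    exact ⟨⟨S, hS⟩⟩
  obtain ⟨m₁, hm₁, hm₁'⟩ := exists_balanced_distribution (τ := scatteredSets g c) a
  obtain ⟨m₂, hm₂, hm₂'⟩ := exists_balanced_distribution (τ := Fin g) r
  rw [Fintype.card_coe] at hm₁'
  rw [Fintype.card_fin] at hm₂'
  set D := (scatteredSets g c).card
  let T : scatteredSets g c ⊕ Fin g → Finset (Fin g × Fin (c + 1)) :=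
    Sum.elim Subtype.val (cellGroup g c)
  let m : scatteredSets g c ⊕ Fin g → ℕ := Sum.elim m₁ m₂
  let s : Fin g × Fin (c + 1) → ℕ := fun p => ∑ t ∈ Finset.univ.filter (fun t => p ∈ T t), m t
  have hscard : ∀ S : scatteredSets g c, S.1.card = c := fun S =>
    (Finset.mem_powersetCard.1 (Finset.mem_sdiff.1 S.2).1).2
  have hsnot : ∀ (S : scatteredSets g c) j, ¬ S.1 ⊆ cellGroup g c j := fun S j h =>
    (Finset.mem_sdiff.1 S.2).2 (mem_groupedSets (hscard S) j h)
  have hLs : ∀ p, L ≤ s p := by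
    intro p
    have hsum : s p = ∑ S : scatteredSets g c, (if p ∈ S.1 then m₁ S else 0) + m₂ p.1 := by
      simp only [s, Finset.sum_filter, Fintype.sum_sum_type, T, m, Sum.elim_inl, Sum.elim_inr,
        mem_cellGroup, Finset.sum_ite_eq, Finset.mem_univ, if_true]
      congr!
    have hge : ((scatteredSets g c).filter (fun S => p ∈ S)).card * (a / D) + r / g ≤ s p := by
      rw [hsum]
      refine Nat.add_le_add ?_ (hm₂' _).1
      calc _ = ∑ S ∈ scatteredSets g c, if p ∈ S then a / D else 0 := by
            rw [← Finset.sum_filter, Finset.sum_const, smul_eq_mul]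
        _ = ∑ S : scatteredSets g c, if p ∈ S.1 then a / D else 0 :=
            (Finset.sum_coe_sort (scatteredSets g c) (fun S => if p ∈ S then a / D else 0)).symm
        _ ≤ _ := by
            refine Finset.sum_le_sum fun S _ => ?_
            split_ifs
            · exact (hm₁' S).1
            · exact le_rfl
    have hdeg := mul_card_scatteredSets_le g c hc p
    have hd1 : a < D * (a / D) + D := Nat.lt_mul_div_succ a hD
    have hd2 : r < g * (r / g) + g := Nat.lt_mul_div_succ r hg
    have hM : 0 < g * (c + 1) := Nat.mul_pos hg c.succ_pos
    refine Nat.le_of_mul_le_mul_left ?_ hM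
    refine le_trans ?_ (Nat.mul_le_mul_left _ hge)
    -- Rounding down a/D and r/g costs at most cD and (c + 1)g = M in M · `s p`; this is the error
    -- term in `hL`.
    have e1 : c * a ≤ c * (D * (a / D) + D) := Nat.mul_le_mul_left _ hd1.le
    have e2 : (c + 1) * r ≤ (c + 1) * (g * (r / g) + g) := Nat.mul_le_mul_left _ hd2.le
    have e3 := Nat.mul_le_mul_right (a / D) hdeg
    nlinarith
  have hprod : ∀ S : Finset (Fin g × Fin (c + 1)), L ^ S.card ≤ ∏ p ∈ S, s p := fun S =>
    Finset.pow_card_le_prod S s L (fun p _ => hLs p)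
  have key := le_SP_of_types T m s N (fun p => rfl) (by
      rintro (S | j)
      · refine le_trans ?_ (hprod _)
        change N * m₁ S ≤ L ^ S.1.card
        rw [hscard]
        exact le_trans (Nat.mul_le_mul_left _ (hm₁' S).2) h1
      · refine le_trans ?_ (hprod _)
        change N * m₂ j ≤ L ^ (cellGroup g c j).card
        rw [card_cellGroup]
        exact le_trans (Nat.mul_le_mul_left _ (hm₂' j).2) h2)
    (by
      rintro (S | j)
      · exact Finset.card_pos.1 ((hscard S).symm ▸ hc)
      · exact Finset.card_pos.1 ((card_cellGroup g c j).symm ▸ c.succ_pos))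
    (by
      rintro (S | j) (S' | j') h
      · exact congrArg Sum.inl (Subtype.ext (Finset.eq_of_subset_of_card_le h
          ((hscard S').trans (hscard S).symm).le))
      · exact (hsnot S j' h).elim
      · have := Finset.card_le_card h
        change (cellGroup g c j).card ≤ S'.1.card at this
        rw [card_cellGroup, hscard] at this
        omega
      · have : ((j, 0) : Fin g × Fin (c + 1)) ∈ cellGroup g c j' :=
          h (mem_cellGroup.2 rfl)
        exact congrArg Sum.inr (mem_cellGroup.1 this))
    (by simp only [m, Fintype.sum_sum_type, Sum.elim_inl, Sum.elim_inr, hm₁]; omega)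
  have e1 : ∑ t, m t = a + r := by
    simp only [m, Fintype.sum_sum_type, Sum.elim_inl, Sum.elim_inr, hm₁, hm₂]
  have e2 : ∑ t, m t * (T t).card = c * a + (c + 1) * r := by
    simp only [m, T, Fintype.sum_sum_type, Sum.elim_inl, Sum.elim_inr, hscard, card_cellGroup,
      ← Finset.sum_mul, hm₁, hm₂]
    ring
  rwa [e1, e2] at key

/-! ### Asymptotics. -/

/-- After division by a power of n, the required estimates become inequalities between continuous
functions of x = 1/n, to be checked at x = 0 only. -/
theorem eventually_lt_of_continuous_inv {u v : ℝ → ℝ} (hu : Continuous u) (hv : Continuous v)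
    (h : u 0 < v 0) : ∀ᶠ n : ℕ in atTop, u ((n : ℝ)⁻¹) < v ((n : ℝ)⁻¹) := by
  have hopen : IsOpen {x | u x < v x} := isOpen_lt hu hv
  exact (tendsto_inv_atTop_nhds_zero_nat (𝕜 := ℝ)).eventually (hopen.mem_nhds h)

/-- Almost all `c`-sets of cells are scattered, if there are many cells. -/
theorem exists_card_scatteredSets_gt {c : ℕ} (hc : 2 ≤ c) {ε : ℝ} (hε : 0 < ε) :
    ∃ g : ℕ, 0 < g ∧ (1 - ε) * ((g * (c + 1) : ℕ) : ℝ) ^ c <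
      c.factorial * ((scatteredSets g c).card : ℝ) := by
  -- At x = 1/M the right side bounds c! D/M^c from below: C(M, c) gives (1 - cx)^c, and the M
  -- grouped sets cost c! M^(1-c) ≤ c! x because c ≥ 2.
  have h1 := eventually_lt_of_continuous_inv (u := fun _ => 1 - ε)
    (v := fun x => (1 - c * x) ^ c - c.factorial * x) (by fun_prop) (by fun_prop)
    (by simpa using hε)
  obtain ⟨M₀, hM₀⟩ := eventually_atTop.1 h1
  refine ⟨M₀ + c + 1, by omega, ?_⟩
  have hD := card_scatteredSets (M₀ + c + 1) c (by omega)
  have hMge : M₀ + c + 1 ≤ (M₀ + c + 1) * (c + 1) := Nat.le_mul_of_pos_right _ c.succ_pos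
  set M := (M₀ + c + 1) * (c + 1)
  set D := (scatteredSets (M₀ + c + 1) c).card
  have h2 := hM₀ M (by omega)
  have hM : (0 : ℝ) < M := by exact_mod_cast (by omega : 0 < M)
  have h3 : (((M + 1 - c : ℕ) : ℝ) ^ c) / c.factorial ≤ M.choose c := by
    exact_mod_cast Nat.pow_le_choose (α := ℝ) c M
  have hf : (0 : ℝ) < c.factorial := by exact_mod_cast c.factorial_pos
  rw [div_le_iff₀ hf] at h3
  have h4 : ((M : ℝ) - c) ^ c ≤ ((M + 1 - c : ℕ) : ℝ) ^ c := by
    have : (c : ℝ) ≤ M := by exact_mod_cast (by omega : c ≤ M)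
    refine pow_le_pow_left₀ (by linarith) ?_ c
    rw [Nat.cast_sub (by omega)]
    push_cast
    linarith
  have h5 : (M : ℝ) ≤ M ^ c * (M : ℝ)⁻¹ := by
    rw [← div_eq_mul_inv, le_div_iff₀ hM, ← sq]
    exact pow_le_pow_right₀ (by exact_mod_cast (by omega : 1 ≤ M)) hc
  have h6 : (M : ℝ) ^ c * (1 - c * (M : ℝ)⁻¹) ^ c = ((M : ℝ) - c) ^ c := by
    rw [← mul_pow]
    congr 1
    field_simp
  have hD' : (D : ℝ) + M = M.choose c := by exact_mod_cast hD
  calc (1 - ε) * (M : ℝ) ^ c < ((1 - c * (M : ℝ)⁻¹) ^ c - c.factorial * (M : ℝ)⁻¹) * M ^ c :=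
        mul_lt_mul_of_pos_right h2 (by positivity)
    _ = ((M : ℝ) - c) ^ c - c.factorial * (M ^ c * (M : ℝ)⁻¹) := by rw [← h6]; ring
    _ ≤ (M.choose c : ℝ) * c.factorial - c.factorial * M := by
        have := mul_le_mul_of_nonneg_left h5 hf.le
        linarith
    _ = c.factorial * D := by rw [← hD']; ring

/-- For `c` and `δ` fixed, `SP n k` is at least `(1 - ε) * C(n, c) / (k - r)` for all large `n`. -/
theorem eventually_le_SP {c : ℕ} (hc : 2 ≤ c) {δ ε : ℝ} (hδ : 0 < δ) (hε : 0 < ε) (hε1 : ε < 1) :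
    ∀ᶠ n : ℕ in atTop, ∀ k : ℕ, 0 < k → quo n k = c → δ * n ≤ (k : ℝ) - rem n k →
      (1 - ε) * ((n.choose c : ℝ) / ((k : ℝ) - rem n k)) ≤ SP n k := by
  -- Using ε/2 here leaves slack for a strict inequality in the limit below.
  obtain ⟨g, hg, hgD⟩ := exists_card_scatteredSets_gt hc (half_pos hε)
  set M : ℕ := g * (c + 1) with hMdef
  set D := (scatteredSets g c).card with hDdef
  have hM : 0 < M := Nat.mul_pos hg c.succ_pos
  have hMR : (0 : ℝ) < M := by exact_mod_cast hM
  have hf : (0 : ℝ) < c.factorial := by exact_mod_cast c.factorial_pos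
  have hDR : (0 : ℝ) < D := by
    have : 0 < (1 - ε / 2) * (M : ℝ) ^ c := mul_pos (by linarith) (by positivity)
    exact pos_of_mul_pos_right (this.trans hgD) hf.le
  have hD : 0 < D := by exact_mod_cast hDR
  set K : ℕ := c * D + M with hK
  -- This is N(a/D + 1) ≤ L^c divided by n^c, where N ≈ (1 - ε)C(n, c)/a and L = ⌊(n - K)/M⌋. The
  -- coefficient 1/(c! δ) comes from C(n, c)/a with a ≥ δn, and 2 from a/D + 1 ≤ 2n.
  have ev1 := eventually_lt_of_continuous_inv
    (u := fun x => (1 - ε) / (c.factorial * D) + (1 / (c.factorial * δ) + 2) * x)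
    (v := fun x => ((1 - (K + M) * x) / M) ^ c) (by fun_prop) (by fun_prop) (by
      simp only [mul_zero, add_zero, sub_zero, one_div, inv_pow]
      rw [div_lt_iff₀ (by positivity), ← div_eq_inv_mul, lt_div_iff₀ (by positivity)]
      refine lt_of_le_of_lt ?_ hgD
      exact mul_le_mul_of_nonneg_right (by linarith) (by positivity))
  -- This is N(r/g + 1) ≤ L^(c+1) divided by n^(c+1), with N ≤ (1/δ + 1)n^(c-1) and r/g + 1 ≤ 2n.
  have ev2 := eventually_lt_of_continuous_inv
    (u := fun x => (1 / δ + 1) * 2 * x)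
    (v := fun x => ((1 - (K + M) * x) / M) ^ (c + 1)) (by fun_prop) (by fun_prop) (by
      simp only [mul_zero, sub_zero]
      positivity)
  filter_upwards [ev1, ev2, eventually_ge_atTop (K + M)] with n hn1 hn2 hnK k hk hquo hδk
  have hnk : n = c * k + rem n k := by
    rw [← hquo, mul_comm]; exact (Nat.div_add_mod n k).symm
  have hr : rem n k < k := Nat.mod_lt n hk
  set r := rem n k
  obtain ⟨a, ha, hak⟩ : ∃ a, 0 < a ∧ k = a + r := ⟨k - r, by omega, by omega⟩
  have haR : (0 : ℝ) < a := by exact_mod_cast ha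
  have hkr : (k : ℝ) - r = a := by rw [hak]; push_cast; ring
  rw [hkr] at hδk ⊢
  have hn' : n = c * a + (c + 1) * r := by rw [hnk, hak]; ring
  have hn0 : (0 : ℝ) < n := by exact_mod_cast (by omega : 0 < n)
  have hn1' : (1 : ℝ) ≤ n := by exact_mod_cast (by omega : 1 ≤ n)
  set N := ⌈(1 - ε) * ((n.choose c : ℝ) / a)⌉₊ with hN
  set L := (n - K) / M with hL
  have hLR : (n : ℝ) * ((1 - (K + M) * (n : ℝ)⁻¹) / M) ≤ L := by
    have h1 : n - K < M * L + M := Nat.lt_mul_div_succ _ hM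
    have h2 : (n : ℝ) ≤ M * L + M + K := by exact_mod_cast (by omega : n ≤ M * L + M + K)
    rw [← mul_div_assoc, div_le_iff₀ hMR, mul_sub, mul_one, mul_left_comm,
      mul_inv_cancel₀ hn0.ne', mul_one]
    linarith
  have hbase : 0 ≤ (1 - (K + M) * (n : ℝ)⁻¹) / M := by
    refine div_nonneg ?_ hMR.le
    rw [sub_nonneg, ← div_eq_mul_inv, div_le_one hn0]
    exact_mod_cast hnK
  have hLpow : ∀ e, (n : ℝ) ^ e * ((1 - (K + M) * (n : ℝ)⁻¹) / M) ^ e ≤ (L : ℝ) ^ e := by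
    intro e
    rw [← mul_pow]
    exact pow_le_pow_left₀ (mul_nonneg hn0.le hbase) hLR e
  have hNle : (N : ℝ) ≤ (1 - ε) * ((n.choose c : ℝ) / a) + 1 :=
    (Nat.ceil_lt_add_one (mul_nonneg (by linarith) (by positivity))).le
  have hpow : (n : ℝ) ≤ n ^ c * (n : ℝ)⁻¹ := by
    rw [← div_eq_mul_inv, le_div_iff₀ hn0, ← sq]
    exact pow_le_pow_right₀ hn1' hc
  have han : (a : ℝ) ≤ n := by
    have : a ≤ n := by rw [hn']; nlinarith
    exact_mod_cast this
  have hrn : (r : ℝ) ≤ n := by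
    have : r ≤ n := by rw [hn']; nlinarith
    exact_mod_cast this
  have hchoose : (n.choose c : ℝ) ≤ n ^ c / c.factorial := Nat.choose_le_pow_div c n
  have hinva : 1 / (a : ℝ) ≤ 1 / δ * (n : ℝ)⁻¹ := by
    rw [← one_div, div_mul_div_comm, one_mul]
    exact one_div_le_one_div_of_le (by positivity) hδk
  have hcond1 : N * (a / D + 1) ≤ L ^ c := by
    have hdiv : ((a / D : ℕ) : ℝ) ≤ (a : ℝ) / D := Nat.cast_div_le
    have hD1 : (1 : ℝ) ≤ D := by exact_mod_cast hD
    have hdiv' : (a : ℝ) / D ≤ a := div_le_self haR.le hD1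
    have : (N : ℝ) * ((a / D : ℕ) + 1) ≤ (L : ℝ) ^ c := by
      calc (N : ℝ) * ((a / D : ℕ) + 1)
          ≤ ((1 - ε) * ((n.choose c : ℝ) / a) + 1) * ((a : ℝ) / D + 1) :=
            mul_le_mul hNle (by linarith) (by positivity)
              (add_nonneg (mul_nonneg (by linarith) (by positivity)) zero_le_one)
        _ = (n.choose c : ℝ) * ((1 - ε) / D) + (n.choose c : ℝ) * ((1 - ε) * (1 / a)) +
              ((a : ℝ) / D + 1) := by
            field_simp
        _ ≤ (n ^ c / c.factorial) * ((1 - ε) / D) +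
              (n ^ c / c.factorial) * (1 / δ * (n : ℝ)⁻¹) + 2 * (n ^ c * (n : ℝ)⁻¹) := by
            refine add_le_add (add_le_add ?_ ?_) ?_
            · exact mul_le_mul_of_nonneg_right hchoose (div_nonneg (by linarith) hDR.le)
            · refine mul_le_mul hchoose ?_ (mul_nonneg (by linarith) (by positivity))
                (by positivity)
              refine le_trans ?_ hinva
              exact mul_le_of_le_one_left (by positivity) (by linarith)
            · linarith
        _ = n ^ c * ((1 - ε) / (c.factorial * D) +
              (1 / (c.factorial * δ) + 2) * (n : ℝ)⁻¹) := by
            field_simp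
            ring
        _ ≤ n ^ c * ((1 - (K + M) * (n : ℝ)⁻¹) / M) ^ c :=
            mul_le_mul_of_nonneg_left hn1.le (by positivity)
        _ ≤ _ := hLpow c
    exact_mod_cast this
  have hcond2 : N * (r / g + 1) ≤ L ^ (c + 1) := by
    have hdiv : ((r / g : ℕ) : ℝ) ≤ r := by exact_mod_cast Nat.div_le_self r g
    have hf1 : (1 : ℝ) ≤ c.factorial := by exact_mod_cast c.factorial_pos
    have hN2 : (N : ℝ) ≤ (1 / δ + 1) * (n ^ c * (n : ℝ)⁻¹) := by
      have h1 : (1 - ε) * ((n.choose c : ℝ) / a) ≤ n ^ c * (1 / δ * (n : ℝ)⁻¹) := by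
        calc (1 - ε) * ((n.choose c : ℝ) / a) ≤ (n.choose c : ℝ) / a :=
              mul_le_of_le_one_left (by positivity) (by linarith)
          _ = (n.choose c : ℝ) * (1 / a) := by ring
          _ ≤ _ := mul_le_mul (hchoose.trans (div_le_self (by positivity) hf1)) hinva
              (by positivity) (by positivity)
      calc (N : ℝ) ≤ n ^ c * (1 / δ * (n : ℝ)⁻¹) + n ^ c * (n : ℝ)⁻¹ := by linarith
        _ = _ := by ring
    have : (N : ℝ) * ((r / g : ℕ) + 1) ≤ (L : ℝ) ^ (c + 1) := by
      calc (N : ℝ) * ((r / g : ℕ) + 1)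
          ≤ ((1 / δ + 1) * (n ^ c * (n : ℝ)⁻¹)) * (2 * n) :=
            mul_le_mul hN2 (by linarith) (by positivity) (by positivity)
        _ = n ^ (c + 1) * ((1 / δ + 1) * 2 * (n : ℝ)⁻¹) := by ring
        _ ≤ n ^ (c + 1) * ((1 - (K + M) * (n : ℝ)⁻¹) / M) ^ (c + 1) :=
            mul_le_mul_of_nonneg_left hn2.le (by positivity)
        _ ≤ _ := hLpow (c + 1)
    exact_mod_cast this
  have hcond0 : M * L + K ≤ n := by
    have : M * L ≤ n - K := Nat.mul_div_le (n - K) M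
    omega
  have hfin := le_SP_of_scatteredSets g c a r N L hg (by omega) ha hD
    (by rw [← hn']; exact hcond0) hcond1 hcond2
  rw [← hn', ← hak] at hfin
  calc (1 - ε) * ((n.choose c : ℝ) / a) ≤ N := Nat.le_ceil _
    _ ≤ _ := by exact_mod_cast hfin

/-- Lets the lower bound be proved against C(n, c)/(k - r), with no estimate of the dropped term. -/
theorem MMS_le_choose_div {n k : ℕ} (hk : 0 < k) (hc : quo n k < n) :
    MMS n k ≤ (n.choose (quo n k) : ℝ) / ((k : ℝ) - rem n k) := by
  have h1 : (rem n k : ℝ) < k := by exact_mod_cast Nat.mod_lt n hk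
  have h2 : (quo n k : ℝ) < n := by exact_mod_cast hc
  have h3 : 0 ≤ (rem n k : ℝ) * ((quo n k : ℝ) + 1) / ((n : ℝ) - quo n k) :=
    div_nonneg (by positivity) (by linarith)
  exact div_le_div_of_nonneg_left (by positivity) (by linarith) (by linarith)

theorem theorem2 {ι : Type*} (l : Filter ι) (n k : ι → ℕ)
    (hn : Tendsto n l atTop)
    (hk_pos : ∀ᶠ i in l, 1 ≤ k i)
    (hk : ∀ᶠ i in l, (k i : ℝ) ≤ (n i : ℝ) / 2)
    (hkr : (fun i => (k i : ℝ) - (rem (n i) (k i) : ℝ)) =Θ[l] fun i => (n i : ℝ)) :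
    (fun i => (SP (n i) (k i) : ℝ)) ~[l] fun i => MMS (n i) (k i) := by
  obtain ⟨C, hC, hCn⟩ := hkr.2.exists_pos
  rw [IsBigOWith_def] at hCn
  refine isLittleO_iff.2 fun η hη => ?_
  have hε : 0 < min η (1 / 2) := lt_min hη (by norm_num)
  have hε1 : min η (1 / 2) < 1 := (min_le_right _ _).trans_lt (by norm_num)
  -- Since c ≤ n/k ≤ n/(k - r) ≤ C, only finitely many c occur, and their thresholds combine into
  -- one.
  have hlow : ∀ᶠ m : ℕ in atTop, ∀ c ∈ Finset.Icc 2 ⌊C⌋₊, ∀ k : ℕ, 0 < k → quo m k = c →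
      C⁻¹ * m ≤ (k : ℝ) - rem m k →
      (1 - min η (1 / 2)) * ((m.choose c : ℝ) / ((k : ℝ) - rem m k)) ≤ SP m k :=
    (Finset.eventually_all _).2 fun c hc =>
      eventually_le_SP (Finset.mem_Icc.1 hc).1 (inv_pos.2 hC) hε hε1
  filter_upwards [hk_pos, hk, hCn, hn.eventually hlow,
    hn.eventually (eventually_gt_atTop ⌊C⌋₊)] with i hki hkn hCi hlowi hCni
  have hr : (rem (n i) (k i) : ℝ) < k i := by exact_mod_cast Nat.mod_lt (n i) hki
  have hkR : (0 : ℝ) < k i := by exact_mod_cast hki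
  rw [Real.norm_of_nonneg (by positivity), Real.norm_of_nonneg (by linarith)] at hCi
  have hqC : quo (n i) (k i) ≤ ⌊C⌋₊ := by
    refine Nat.le_floor ?_
    calc ((n i / k i : ℕ) : ℝ) ≤ (n i : ℝ) / k i := Nat.cast_div_le
      _ ≤ C := by
        rw [div_le_iff₀ hkR]
        refine hCi.trans (mul_le_mul_of_nonneg_left ?_ hC.le)
        linarith [(Nat.cast_nonneg (rem (n i) (k i)) : (0 : ℝ) ≤ _)]
  have hq2 : 2 ≤ quo (n i) (k i) := by
    refine (Nat.le_div_iff_mul_le hki).2 ?_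
    have : (2 : ℝ) * k i ≤ n i := by linarith
    exact_mod_cast this
  have hqn : quo (n i) (k i) < n i := hqC.trans_lt hCni
  have hup := SP_le_MMS hki hqn
  have hlo := hlowi _ (Finset.mem_Icc.2 ⟨hq2, hqC⟩) (k i) hki rfl (by
    rw [inv_mul_le_iff₀ hC]; exact hCi)
  have hMMS : 0 ≤ MMS (n i) (k i) := (Nat.cast_nonneg _).trans hup
  have hlo' := (mul_le_mul_of_nonneg_left (MMS_le_choose_div hki hqn)
    (by linarith : (0 : ℝ) ≤ 1 - min η (1 / 2))).trans hlo
  have hmin := mul_le_mul_of_nonneg_right (min_le_left η (1 / 2)) hMMS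
  rw [Pi.sub_apply, Real.norm_of_nonneg hMMS, Real.norm_eq_abs, abs_le]
  constructor
  · linarith
  · linarith [mul_nonneg hη.le hMMS]
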